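/- For $n\ge 1$ let $J_n$ be the number of sign vectors $(\delta_0,\dots,\delta_n)\in\{-1,1\}^{n+1}$ with $\sum_{i=0}^n\delta_i\binom{n}{i}=0$. Let $\operatorname{erf}(z)=\frac{2}{\sqrt{\pi}}\int_0^z e^{-t^2}\,dt$, let $H(\alpha)=-\alpha\log_2\alpha-(1-\alpha)\log_2(1-\alpha)$ be the binary entropy function, and put $b_j=\binom{n}{j}$ and $\alpha_s=\frac{\lfloor n/2\rfloor-s}{n}$ for $1\le s\le\lfloor n/2\rfloor-1$. Then there are real numbers $\varepsilon_{n,s}$ with $\max_{1\le s\le\lfloor n/2\rfloor-1}|\varepsilon_{n,s}|\to 0$ as $n\to\infty$ such that for every $n\ge 5$ $$2^{-(n+2)}J_n\le\frac{\operatorname{erf}\left(\frac{\pi\sqrt{\binom{2n}{n}}}{2\binom{n}{\lfloor n/2\rfloor}}\right)}{2\sqrt{\pi\binom{2n}{n}}}+\sum_{s=1}^{\lfloor n/2\rfloor-1}\exp\left(-\frac{\pi^2\,2^{2n(H(\alpha_s)+\varepsilon_{n,s})}}{4(\lfloor n/2\rfloor+1)\,b_{\lfloor n/2\rfloor-s+1}^2}\right)\frac{s}{(\lfloor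 n/2\rfloor-s+1)\,b_{\lfloor n/2\rfloor-s+1}}.$$ Moreover, for $n\ge 6$ one can take for $\varepsilon_{n,s}$ the numbers determined by $\sum_{k=0}^{\lfloor n/2\rfloor-s}\binom{n}{k}=2^{n(H(\alpha_s)+\varepsilon_{n,s})}$. -/

import Mathlib

/-- The solutions of the binomial coefficient bisection problem: sign vectors
`(δ₀, …, δₙ)` (the units of `ℤ` are exactly `1` and `-1`) with `∑ δᵢ * C(n, i) = 0`. -/
def bisectionSolutions (n : ℕ) : Finset (Fin (n + 1) → ℤˣ) :=
  Finset.univ.filter fun δ => ∑ i, (δ i : ℤ) * (n.choose i : ℤ) = 0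

/-- `J n` is the number of solutions of the bisection problem. -/
def bisectionCount (n : ℕ) : ℕ := (bisectionSolutions n).card

/-- The error function. -/
noncomputable def erf (z : ℝ) : ℝ :=
  2 / Real.sqrt Real.pi * ∫ t in (0 : ℝ)..z, Real.exp (-t ^ 2)

/-- The binary entropy function, in bits. -/
noncomputable def entropyTwo (a : ℝ) : ℝ :=
  -a * Real.logb 2 a - (1 - a) * Real.logb 2 (1 - a)

/-- `α_s = (⌊n/2⌋ - s) / n`; only used for `1 ≤ s ≤ ⌊n/2⌋ - 1`, where it lies in `(0, 1/2)`. -/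
noncomputable def alphaRatio (n s : ℕ) : ℝ := ((n / 2 - s : ℕ) : ℝ) / (n : ℝ)

/-! The two sides have different orders, so crude bounds suffice. For `n ≥ 6` the summand `s = ⌊n/2⌋
- 1` alone is at least about `1 / (2n)`: its partial sum is `1 + n`, so its exponential is close to
`1` (`le_exp_mul_last_term`). The left side is exponentially small: `C(n,0), ..., C(n,q)` with `q =
⌊(n+1)/3⌋` are superincreasing, so a solution is determined by its other signs and `J_n ≤ 2 ^ (n -
q)`. This wins from `n = 8` on; `n = 6, 7` use exact counts, and `n = 5` also needs the erf term.
The errors vanish uniformly because `2 ^ (n H(j/n))` agrees with the partial binomial sum up to a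
factor `n + 1`. -/

theorem bisectionCount_five : bisectionCount 5 = 8 := by decide +kernel
theorem bisectionCount_six : bisectionCount 6 = 2 := by decide +kernel
theorem bisectionCount_seven : bisectionCount 7 = 16 := by decide +kernel

/-! ### Counting solutions -/

/-- A superincreasing sequence admits no nontrivial relation with coefficients in `{-2, 0, 2}`. -/
theorem eq_zero_of_superincreasing (b : ℕ → ℕ) (d : ℕ → ℤ)
    (hd : ∀ i, d i = -2 ∨ d i = 0 ∨ d i = 2) (k : ℕ)
    (hb : ∀ i < k, ∑ j ∈ Finset.range i, b j < b i)
    (h : ∑ i ∈ Finset.range k, d i * (b i : ℤ) = 0) : ∀ i < k, d i = 0 := by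
  induction k with
  | zero => intro i hi; omega
  | succ k ih =>
    rw [Finset.sum_range_succ] at h
    have hlt : (∑ j ∈ Finset.range k, (b j : ℤ)) < b k := by exact_mod_cast hb k (by omega)
    have habs : |∑ i ∈ Finset.range k, d i * (b i : ℤ)| ≤ 2 * ∑ i ∈ Finset.range k, (b i : ℤ) := by
      rw [Finset.mul_sum]
      refine (Finset.abs_sum_le_sum_abs _ _).trans (Finset.sum_le_sum fun i _ => ?_)
      rw [abs_mul, Nat.abs_cast]
      gcongr
      rcases hd i with h | h | h <;> simp [h]
    rw [abs_le] at habs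
    -- A nonzero top term has size `2 * b k`, more than all lower terms together.
    have hk : d k = 0 := by
      rcases hd k with h' | h' | h'
      · rw [h'] at h; omega
      · exact h'
      · rw [h'] at h; omega
    rw [hk, zero_mul, add_zero] at h
    intro i hi
    rcases Nat.lt_succ_iff_lt_or_eq.1 hi with hi | rfl
    · exact ih (fun i hi => hb i (by omega)) h i hi
    · exact hk

/-- If the first `k` binomial coefficients are superincreasing, a solution of the bisection problem
is determined by all but its last `k` signs. -/
theorem bisectionCount_mul_two_pow_le (n k : ℕ) (hk : k ≤ n + 1)
    (hb : ∀ i < k, ∑ j ∈ Finset.range i, n.choose j < n.choose i) :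
    bisectionCount n * 2 ^ k ≤ 2 ^ (n + 1) := by
  have hcard : bisectionCount n ≤ 2 ^ (n + 1 - k) := by
    have hle : n + 1 - k ≤ n + 1 := Nat.sub_le _ _
    have := Finset.card_le_card_of_injOn (s := bisectionSolutions n)
      (t := (Finset.univ : Finset (Fin (n + 1 - k) → ℤˣ)))
      (fun δ i => δ (Fin.castLE hle i)) (fun _ _ => Finset.mem_coe.2 (Finset.mem_univ _)) ?_
    · simpa [bisectionCount] using this
    intro δ hδ δ' hδ' heq
    simp only [bisectionSolutions, Finset.coe_filter, Finset.mem_univ, true_and,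
      Set.mem_ofPred_eq] at hδ hδ'
    -- Reversing the indices keeps the binomial coefficients and moves the last `k` signs, where `δ`
    -- and `δ'` may differ, to the front.
    set d : ℕ → ℤ := fun j => if h : j < n + 1 then
      (δ (Fin.rev ⟨j, h⟩) : ℤ) - (δ' (Fin.rev ⟨j, h⟩) : ℤ) else 0 with hd
    have hd2 : ∀ i, d i = -2 ∨ d i = 0 ∨ d i = 2 := by
      intro i
      simp only [hd]
      split_ifs with h
      · rcases Int.units_eq_one_or (δ (Fin.rev ⟨i, h⟩)) with h1 | h1 <;>
        rcases Int.units_eq_one_or (δ' (Fin.rev ⟨i, h⟩)) with h2 | h2 <;> simp [h1, h2]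
      · simp
    have hd0 : ∀ i, k ≤ i → d i = 0 := by
      intro i hi
      simp only [hd]
      split_ifs with h
      · have := congrFun heq ⟨n - i, by omega⟩
        have hrev : Fin.castLE hle ⟨n - i, by omega⟩ = Fin.rev ⟨i, h⟩ := by
          ext; simp [Fin.val_rev]
        simp only [hrev] at this
        rw [this, sub_self]
      · rfl
    have hsum : ∑ i ∈ Finset.range (n + 1), d i * (n.choose i : ℤ) = 0 := by
      rw [Finset.sum_range, ← Equiv.sum_comp Fin.revPerm]
      calc _ = ∑ i : Fin (n + 1), ((δ i : ℤ) * (n.choose i : ℤ) - (δ' i : ℤ) * (n.choose i : ℤ)) := by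
            refine Finset.sum_congr rfl fun i _ => ?_
            have hi : n.choose (Fin.rev i : Fin (n + 1)) = n.choose i := by
              rw [Fin.val_rev, show n + 1 - ((i : ℕ) + 1) = n - i by omega,
                Nat.choose_symm (by omega)]
            simp only [hd, Fin.revPerm_apply, hi, Fin.is_lt, dite_true, Fin.eta, Fin.rev_rev]
            ring
        _ = 0 := by rw [Finset.sum_sub_distrib, hδ, hδ', sub_zero]
    have hsumk : ∑ i ∈ Finset.range k, d i * (n.choose i : ℤ) = 0 := by
      rw [← hsum]
      refine Finset.sum_subset (Finset.range_subset_range.2 hk) fun i _ hi => ?_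
      rw [hd0 i (by simpa using hi), zero_mul]
    have hzero := eq_zero_of_superincreasing _ d hd2 k hb hsumk
    funext i
    have : d (Fin.rev i) = 0 := by
      rcases lt_or_ge ((Fin.rev i : Fin (n + 1)) : ℕ) k with h | h
      · exact hzero _ h
      · exact hd0 _ h
    simp only [hd, Fin.is_lt, dite_true, Fin.eta, Fin.rev_rev] at this
    exact Units.ext (sub_eq_zero.1 this)
  calc bisectionCount n * 2 ^ k ≤ 2 ^ (n + 1 - k) * 2 ^ k := Nat.mul_le_mul_right _ hcard
    _ = 2 ^ (n + 1) := by rw [← pow_add, Nat.sub_add_cancel hk]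

/-- In this range each coefficient is at least twice the previous one. -/
theorem sum_range_choose_lt_choose (n i : ℕ) (hi : 3 * i ≤ n + 1) :
    ∑ j ∈ Finset.range i, n.choose j < n.choose i := by
  induction i with
  | zero => simp
  | succ i ih =>
    rw [Finset.sum_range_succ]
    have h1 := ih (by omega)
    have h2 := Nat.choose_succ_right_eq n i
    have h3 : n.choose i * (2 * (i + 1)) ≤ n.choose i * (n - i) :=
      Nat.mul_le_mul_left _ (by omega)
    have h4 : 2 * n.choose i ≤ n.choose (i + 1) := by
      refine Nat.le_of_mul_le_mul_right (c := i + 1) ?_ (by omega)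
      rw [h2]; linarith
    omega

theorem bisectionCount_mul_two_pow_third_le (n : ℕ) (hn : 1 ≤ n) :
    bisectionCount n * 2 ^ ((n + 1) / 3 + 1) ≤ 2 ^ (n + 1) :=
  bisectionCount_mul_two_pow_le n _ (by omega) fun i hi =>
    sum_range_choose_lt_choose n i (by omega)

/-! ### Entropy estimate -/

/-- The terms of the binomial expansion of `(j + (n - j)) ^ n` are largest at index `j`. -/
theorem choose_mul_pow_mul_pow_le (n j k : ℕ) (hj : j ≤ n) (hk : k ≤ n) :
    j ^ k * (n - j) ^ (n - k) * n.choose k ≤ j ^ j * (n - j) ^ (n - j) * n.choose j := by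
  -- Cross-multiplied ratio of consecutive terms: `(n - i) * j` against `(i + 1) * (n - j)`, which
  -- changes order at `i = j`.
  have step : ∀ i < n, j ^ (i + 1) * (n - j) ^ (n - (i + 1)) * n.choose (i + 1) * (i + 1) * (n - j)
      = j ^ i * (n - j) ^ (n - i) * n.choose i * ((n - i) * j) := by
    intro i hi
    have h2 := Nat.choose_succ_right_eq n i
    have h3 : (n - j) ^ (n - i) = (n - j) ^ (n - (i + 1)) * (n - j) := by
      rw [← pow_succ]; congr 1; omega
    rw [h3, pow_succ]
    linear_combination (j ^ i * j * (n - j) ^ (n - (i + 1)) * (n - j)) * h2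
  rcases Nat.eq_zero_or_pos j with rfl | hj0
  · rcases Nat.eq_zero_or_pos k with rfl | hk0
    · rfl
    · simp [zero_pow hk0.ne']
  rcases hj.eq_or_lt with rfl | hjn
  · rcases hk.eq_or_lt with rfl | hk
    · rfl
    · simp [zero_pow (Nat.sub_pos_of_lt hk).ne']
  obtain ⟨r, rfl⟩ : ∃ r, n = j + r := ⟨n - j, by omega⟩
  have hr : 0 < r := by omega
  simp only [Nat.add_sub_cancel_left] at step ⊢
  rcases le_total k j with hkj | hkj
  · refine Nat.decreasingInduction' (P := fun k => j ^ k * r ^ (j + r - k) * (j + r).choose k ≤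
      j ^ j * r ^ r * (j + r).choose j) (fun i hij _ ih => ?_) hkj (by simp)
    refine le_trans ?_ ih
    have := step i (by omega)
    refine Nat.le_of_mul_le_mul_right (c := (i + 1) * r) ?_ (by positivity)
    rw [← mul_assoc (_ * _) (i + 1) r, ← mul_assoc (_ * _) (i + 1) r, this, mul_assoc _ (i + 1) r]
    refine Nat.mul_le_mul_left _ ?_
    obtain ⟨t, rfl⟩ : ∃ t, j = i + 1 + t := ⟨j - (i + 1), by omega⟩
    rw [show i + 1 + t + r - i = 1 + t + r by omega]
    nlinarith
  · induction k, hkj using Nat.le_induction with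
    | base => simp
    | succ i hji ih =>
      refine le_trans ?_ (ih (by omega))
      have := step i (by omega)
      refine Nat.le_of_mul_le_mul_right (c := (i + 1) * r) ?_ (by positivity)
      rw [← mul_assoc, this]
      refine Nat.mul_le_mul_left _ ?_
      obtain ⟨t, rfl⟩ : ∃ t, i = j + t := ⟨i - j, by omega⟩
      rw [show j + r - (j + t) = r - t by omega]
      have : r - t ≤ r := Nat.sub_le _ _
      nlinarith

theorem pow_self_le_succ_mul_choose (n j : ℕ) (hj : j ≤ n) :
    n ^ n ≤ (n + 1) * (j ^ j * (n - j) ^ (n - j) * n.choose j) := by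
  calc n ^ n = (j + (n - j)) ^ n := by rw [Nat.add_sub_cancel' hj]
    _ = ∑ k ∈ Finset.range (n + 1), j ^ k * (n - j) ^ (n - k) * n.choose k := add_pow _ _ _
    _ ≤ ∑ _k ∈ Finset.range (n + 1), j ^ j * (n - j) ^ (n - j) * n.choose j :=
        Finset.sum_le_sum fun k hk =>
          choose_mul_pow_mul_pow_le n j k hj (Nat.lt_succ_iff.1 (Finset.mem_range.1 hk))
    _ = _ := by simp

/-- Since `j ≤ n - j`, trading factors `j` for `n - j` turns the fixed weight into that of the
`k`-th binomial term. -/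
theorem sum_range_choose_mul_le_pow_self (n j : ℕ) (hj : 2 * j ≤ n) :
    (∑ k ∈ Finset.range (j + 1), n.choose k) * (j ^ j * (n - j) ^ (n - j)) ≤ n ^ n := by
  calc (∑ k ∈ Finset.range (j + 1), n.choose k) * (j ^ j * (n - j) ^ (n - j))
      ≤ ∑ k ∈ Finset.range (j + 1), j ^ k * (n - j) ^ (n - k) * n.choose k := by
        rw [Finset.sum_mul]
        refine Finset.sum_le_sum fun k hk => ?_
        rw [mul_comm]
        refine Nat.mul_le_mul_right _ ?_
        have hk : k ≤ j := Nat.lt_succ_iff.1 (Finset.mem_range.1 hk)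
        calc j ^ j * (n - j) ^ (n - j) = j ^ k * (j ^ (j - k) * (n - j) ^ (n - j)) := by
              rw [← mul_assoc, ← pow_add, Nat.add_sub_cancel' hk]
          _ ≤ j ^ k * ((n - j) ^ (j - k) * (n - j) ^ (n - j)) := by
              gcongr; omega
          _ = j ^ k * (n - j) ^ (n - k) := by
              rw [← pow_add]; congr 2; omega
    _ ≤ ∑ k ∈ Finset.range (n + 1), j ^ k * (n - j) ^ (n - k) * n.choose k :=
        Finset.sum_le_sum_of_subset (Finset.range_subset_range.2 (by omega))
    _ = (j + (n - j)) ^ n := (add_pow _ _ _).symm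
    _ = n ^ n := by rw [Nat.add_sub_cancel' (by omega)]

theorem mul_entropyTwo_div (n j : ℕ) (hj : 0 < j) (hjn : j < n) :
    (n : ℝ) * entropyTwo ((j : ℝ) / n) =
      Real.logb 2 ((n : ℝ) ^ n) - Real.logb 2 ((j : ℝ) ^ j * ((n - j : ℕ) : ℝ) ^ (n - j)) := by
  have hj' : (0 : ℝ) < j := by exact_mod_cast hj
  have hn' : (0 : ℝ) < n := by exact_mod_cast hj.trans hjn
  have hr : (0 : ℝ) < ((n - j : ℕ) : ℝ) := by exact_mod_cast Nat.sub_pos_of_lt hjn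
  have hcast : ((n - j : ℕ) : ℝ) = n - j := Nat.cast_sub hjn.le
  have h1 : 1 - (j : ℝ) / n = ((n - j : ℕ) : ℝ) / n := by rw [hcast]; field_simp
  rw [entropyTwo, h1, Real.logb_div hj'.ne' hn'.ne', Real.logb_div hr.ne' hn'.ne',
    Real.logb_mul (by positivity) (by positivity), Real.logb_pow, Real.logb_pow, Real.logb_pow]
  field_simp
  rw [hcast]
  ring

/-- The entropy estimate of the partial binomial sums, with an explicit error. -/
theorem abs_logb_sum_choose_div_sub_entropyTwo_le (n j : ℕ) (hj : 0 < j) (hjn : 2 * j ≤ n) :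
    |Real.logb 2 (∑ k ∈ Finset.range (j + 1), (n.choose k : ℝ)) / n - entropyTwo ((j : ℝ) / n)| ≤
      Real.logb 2 ((n : ℝ) + 1) / n := by
  have hn : (0 : ℝ) < n := by exact_mod_cast (by omega : 0 < n)
  have hr : 0 < n - j := by omega
  set S : ℝ := ∑ k ∈ Finset.range (j + 1), (n.choose k : ℝ) with hS
  set W : ℝ := (j : ℝ) ^ j * ((n - j : ℕ) : ℝ) ^ (n - j) with hW
  have hWpos : 0 < W := by positivity
  have hchoose : (n.choose j : ℝ) ≤ S :=
    Finset.single_le_sum (f := fun k => (n.choose k : ℝ)) (fun _ _ => by positivity)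
      (Finset.self_mem_range_succ j)
  have hSpos : 0 < S := lt_of_lt_of_le (by exact_mod_cast Nat.choose_pos (by omega)) hchoose
  have hupper : S * W ≤ (n : ℝ) ^ n := by
    rw [hW, hS]
    exact_mod_cast sum_range_choose_mul_le_pow_self n j hjn
  have hlower : (n : ℝ) ^ n ≤ ((n : ℝ) + 1) * (W * S) := by
    have : (n : ℝ) ^ n ≤ ((n : ℝ) + 1) * (W * n.choose j) := by
      rw [hW]
      exact_mod_cast pow_self_le_succ_mul_choose n j (by omega)
    exact this.trans (by gcongr)
  have h1 := Real.logb_le_logb_of_le one_lt_two (mul_pos hSpos hWpos) hupper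
  have h2 := Real.logb_le_logb_of_le one_lt_two (by positivity) hlower
  rw [Real.logb_mul hSpos.ne' hWpos.ne'] at h1
  rw [Real.logb_mul (by positivity) (by positivity), Real.logb_mul hWpos.ne' hSpos.ne'] at h2
  have h3 := mul_entropyTwo_div n j hj (by omega)
  have h4 : Real.logb 2 S / n - entropyTwo ((j : ℝ) / n) =
      (Real.logb 2 S - n * entropyTwo ((j : ℝ) / n)) / n := by field_simp
  have h5 : 0 ≤ Real.logb 2 ((n : ℝ) + 1) := Real.logb_nonneg one_lt_two (by linarith)
  rw [h4, abs_div, abs_of_pos hn]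
  gcongr
  rw [abs_le, h3]
  constructor <;> linarith

theorem tendsto_logb_succ_div_atTop :
    Filter.Tendsto (fun n : ℕ => Real.logb 2 ((n : ℝ) + 1) / n) Filter.atTop (nhds 0) := by
  have h := (Real.tendsto_pow_log_div_mul_add_atTop 1 (-1) 1 one_ne_zero).comp
    (Filter.tendsto_atTop_add_const_right _ (1 : ℝ) tendsto_natCast_atTop_atTop)
  have h' := h.div_const (Real.log 2)
  rw [zero_div] at h'
  refine h'.congr fun n => ?_
  simp only [Function.comp, Real.logb]
  rw [show 1 * ((n : ℝ) + 1) + -1 = n by ring, pow_one, div_right_comm]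

/-! ### Lower bounds for the right side -/

theorem erf_nonneg {z : ℝ} (hz : 0 ≤ z) : 0 ≤ erf z :=
  mul_nonneg (by positivity)
    (intervalIntegral.integral_nonneg hz fun _ _ => (Real.exp_pos _).le)

theorem four_div_le_erf {z : ℝ} (hz : 1 ≤ z) : 4 / (3 * Real.sqrt Real.pi) ≤ erf z := by
  have hint : ∀ a b : ℝ, IntervalIntegrable (fun t : ℝ => Real.exp (-t ^ 2))
      MeasureTheory.volume a b := fun a b => (by fun_prop : Continuous _).intervalIntegrable _ _
  have h1 : (2 / 3 : ℝ) ≤ ∫ t in (0 : ℝ)..1, Real.exp (-t ^ 2) := by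
    calc (2 / 3 : ℝ) = ∫ t in (0 : ℝ)..1, (1 - t ^ 2) := by
          rw [intervalIntegral.integral_sub (by simp)
            ((by fun_prop : Continuous _).intervalIntegrable _ _)]
          simp; norm_num
      _ ≤ _ := by
          refine intervalIntegral.integral_mono_on zero_le_one
            ((by fun_prop : Continuous _).intervalIntegrable _ _) (hint _ _) fun t _ => ?_
          linarith [Real.add_one_le_exp (-t ^ 2)]
  have h2 : (0 : ℝ) ≤ ∫ t in (1 : ℝ)..z, Real.exp (-t ^ 2) :=
    intervalIntegral.integral_nonneg hz fun _ _ => (Real.exp_pos _).le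
  rw [erf, ← intervalIntegral.integral_add_adjacent_intervals (hint 0 1) (hint 1 z)]
  calc 4 / (3 * Real.sqrt Real.pi) = 2 / Real.sqrt Real.pi * (2 / 3) := by field_simp; norm_num
    _ ≤ _ := by gcongr; linarith

/-- The summand `s = ⌊n/2⌋ - 1` alone is of order `1 / (2 n)`. -/
theorem le_exp_mul_last_term (n : ℕ) (hn : 6 ≤ n) :
    (1 - 20 * ((n : ℝ) + 1) / ((n : ℝ) * (n - 1)) ^ 2) * (((n : ℝ) - 3) / (2 * (n * (n - 1)))) ≤
      Real.exp (-(Real.pi ^ 2 * ((n : ℝ) + 1) ^ 2 /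
        (4 * (((n / 2 : ℕ) : ℝ) + 1) * (n.choose 2 : ℝ) ^ 2))) *
        (((n / 2 - 1 : ℕ) : ℝ) / (2 * (n.choose 2 : ℝ))) := by
  have hn' : (6 : ℝ) ≤ n := by exact_mod_cast hn
  have hm : ((n : ℝ) - 1) / 2 ≤ ((n / 2 : ℕ) : ℝ) := by
    have : (n : ℝ) ≤ 2 * ((n / 2 : ℕ) : ℝ) + 1 := by exact_mod_cast (by omega : n ≤ 2 * (n / 2) + 1)
    linarith
  have hm1 : ((n / 2 - 1 : ℕ) : ℝ) = ((n / 2 : ℕ) : ℝ) - 1 := by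
    rw [Nat.cast_sub (by omega)]; simp
  have hpi : Real.pi ^ 2 ≤ 10 := by nlinarith [Real.pi_lt_d2, Real.pi_pos]
  have hP : (0 : ℝ) < (n : ℝ) * (n - 1) := by nlinarith
  rw [Nat.cast_choose_two]
  have hx : Real.pi ^ 2 * ((n : ℝ) + 1) ^ 2 /
      (4 * (((n / 2 : ℕ) : ℝ) + 1) * ((n : ℝ) * (n - 1) / 2) ^ 2) ≤
      20 * ((n : ℝ) + 1) / ((n : ℝ) * (n - 1)) ^ 2 := by
    rw [div_le_div_iff₀ (by positivity) (by positivity)]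
    have h1 : Real.pi ^ 2 * ((n : ℝ) + 1) ^ 2 ≤
        20 * ((n : ℝ) + 1) * (((n / 2 : ℕ) : ℝ) + 1) := by
      calc Real.pi ^ 2 * ((n : ℝ) + 1) ^ 2 ≤ 10 * ((n : ℝ) + 1) ^ 2 := by gcongr
        _ = 20 * ((n : ℝ) + 1) * (((n : ℝ) + 1) / 2) := by ring
        _ ≤ _ := by gcongr; linarith
    calc _ ≤ 20 * ((n : ℝ) + 1) * (((n / 2 : ℕ) : ℝ) + 1) * ((n : ℝ) * (n - 1)) ^ 2 := by gcongr
      _ = _ := by ring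
  have hexp : 1 - 20 * ((n : ℝ) + 1) / ((n : ℝ) * (n - 1)) ^ 2 ≤
      Real.exp (-(Real.pi ^ 2 * ((n : ℝ) + 1) ^ 2 /
        (4 * (((n / 2 : ℕ) : ℝ) + 1) * ((n : ℝ) * (n - 1) / 2) ^ 2))) := by
    refine le_trans ?_ (Real.add_one_le_exp _)
    linarith
  refine mul_le_mul hexp ?_ (div_nonneg (by linarith) (by positivity)) (Real.exp_pos _).le
  rw [hm1, show (2 : ℝ) * ((n : ℝ) * (n - 1) / 2) = n * (n - 1) by ring,
    div_le_div_iff₀ (by positivity) hP]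
  nlinarith

theorem eight_mul_le_three_mul_two_pow (q : ℕ) (hq : 3 ≤ q) : 8 * q ≤ 3 * 2 ^ q := by
  induction q, hq using Nat.le_induction with
  | base => norm_num
  | succ q hq ih => rw [pow_succ]; omega

theorem bisectionCount_div_le (n : ℕ) (hn : 6 ≤ n) :
    (bisectionCount n : ℝ) / 2 ^ (n + 2) ≤
      (1 - 20 * ((n : ℝ) + 1) / ((n : ℝ) * (n - 1)) ^ 2) *
        (((n : ℝ) - 3) / (2 * (n * (n - 1)))) := by
  obtain rfl | rfl | h8 : n = 6 ∨ n = 7 ∨ 8 ≤ n := by omega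
  · rw [bisectionCount_six]; norm_num
  · rw [bisectionCount_seven]; norm_num
  have hn' : (8 : ℝ) ≤ n := by exact_mod_cast h8
  set q := (n + 1) / 3 with hq
  have hP : (0 : ℝ) < (n : ℝ) * (n - 1) := by nlinarith
  have hcount : (bisectionCount n : ℝ) * 2 ^ (q + 1) ≤ 2 ^ (n + 1) := by
    exact_mod_cast bisectionCount_mul_two_pow_third_le n (by omega)
  have hqn : (n : ℝ) - 1 ≤ 3 * q := by
    have : (n : ℝ) ≤ 3 * q + 1 := by exact_mod_cast (by omega : n ≤ 3 * q + 1)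
    linarith
  have hpow : 8 * (q : ℝ) ≤ 3 * 2 ^ q := by
    exact_mod_cast eight_mul_le_three_mul_two_pow q (by omega)
  have hx : 20 * ((n : ℝ) + 1) / ((n : ℝ) * (n - 1)) ^ 2 ≤ 1 / 10 := by
    rw [div_le_div_iff₀ (by positivity) (by norm_num)]
    have h1 : (7 : ℝ) * n ≤ n * (n - 1) := by nlinarith
    nlinarith
  have hfrac : (5 : ℝ) / (16 * (n - 1)) ≤ ((n : ℝ) - 3) / (2 * (n * (n - 1))) := by
    rw [div_le_div_iff₀ (by nlinarith) (by positivity)]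
    nlinarith
  calc (bisectionCount n : ℝ) / 2 ^ (n + 2) ≤ 1 / (4 * 2 ^ q) := by
        rw [div_le_div_iff₀ (by positivity) (by positivity)]
        calc (bisectionCount n : ℝ) * (4 * 2 ^ q) = 2 * (bisectionCount n * 2 ^ (q + 1)) := by ring
          _ ≤ 2 * 2 ^ (n + 1) := by gcongr
          _ = 1 * 2 ^ (n + 2) := by ring
    -- With `n - 1 ≤ 3 * q` this is `8 * q ≤ 3 * 2 ^ q`, an equality at `q = 3`.
    _ ≤ 9 / 10 * (5 / (16 * (n - 1))) := by
        rw [div_mul_div_comm, div_le_div_iff₀ (by positivity) (by nlinarith)]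
        nlinarith
    _ ≤ _ := by
        refine mul_le_mul (by linarith) hfrac ?_ (by linarith)
        exact div_nonneg (by norm_num) (by linarith)

/-! ### Error term and conclusion -/

/-- The error term: the one in the entropy estimate of the partial binomial sums, except for
`n = 5`, where that choice would make the bound on the number of solutions false. -/
noncomputable def entropyError (n s : ℕ) : ℝ :=
  if n = 5 then -entropyTwo (alphaRatio n s)
  else Real.logb 2 (∑ k ∈ Finset.range (n / 2 - s + 1), (n.choose k : ℝ)) / n -
    entropyTwo (alphaRatio n s)

theorem exists_abs_entropyError_le (η : ℝ) (hη : 0 < η) : ∃ N : ℕ, ∀ n : ℕ, N ≤ n →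
    ∀ s ∈ Finset.Icc 1 (n / 2 - 1), |entropyError n s| ≤ η := by
  obtain ⟨N, hN⟩ := Filter.eventually_atTop.1
    (tendsto_logb_succ_div_atTop.eventually (gt_mem_nhds hη))
  refine ⟨max N 6, fun n hn s hs => ?_⟩
  have h6 : 6 ≤ n := (le_max_right _ _).trans hn
  rw [Finset.mem_Icc] at hs
  rw [entropyError, if_neg (by omega), alphaRatio]
  exact (abs_logb_sum_choose_div_sub_entropyTwo_le n (n / 2 - s) (by omega) (by omega)).trans
    (hN n ((le_max_left _ _).trans hn)).le

theorem sum_range_choose_eq_two_rpow (n s : ℕ) (hn : 6 ≤ n) :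
    (∑ k ∈ Finset.range (n / 2 - s + 1), (n.choose k : ℝ)) =
      (2 : ℝ) ^ ((n : ℝ) * (entropyTwo (alphaRatio n s) + entropyError n s)) := by
  have hn' : (n : ℝ) ≠ 0 := by exact_mod_cast (by omega : n ≠ 0)
  have hpos : 0 < ∑ k ∈ Finset.range (n / 2 - s + 1), (n.choose k : ℝ) :=
    Finset.sum_pos (fun k hk => by
      have := Finset.mem_range.1 hk
      exact_mod_cast Nat.choose_pos (by omega)) (by simp)
  rw [entropyError, if_neg (by omega), add_sub_cancel, mul_div_cancel₀ _ hn',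
    Real.rpow_logb two_pos (by norm_num) hpos]

theorem bisectionCount_five_bound :
    (8 : ℝ) / 2 ^ (5 + 2) ≤ erf (Real.pi * Real.sqrt 252 / (2 * 10)) /
      (2 * Real.sqrt (Real.pi * 252)) + Real.exp (-(Real.pi ^ 2 / 1200)) * (1 / 20) := by
  have hpi0 := Real.pi_pos
  have hpi3 := Real.pi_gt_three
  have hpi : Real.pi < 3.15 := Real.pi_lt_d2
  have hsqrt : Real.sqrt 252 ≤ 16 := Real.sqrt_le_iff.2 ⟨by norm_num, by norm_num⟩
  have hsqrt' : 15 ≤ Real.sqrt 252 := Real.le_sqrt_of_sq_le (by norm_num)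
  have hexp : (99 / 100 : ℝ) ≤ Real.exp (-(Real.pi ^ 2 / 1200)) := by
    refine le_trans ?_ (Real.add_one_le_exp _)
    nlinarith
  have herf : 4 / (3 * Real.sqrt Real.pi) ≤ erf (Real.pi * Real.sqrt 252 / (2 * 10)) :=
    four_div_le_erf (by rw [le_div_iff₀ (by norm_num)]; nlinarith)
  -- The left side is `0.0625` and the exponential term gives `0.0495`, so `0.013` is needed here.
  have hmain : (0.0131 : ℝ) ≤ erf (Real.pi * Real.sqrt 252 / (2 * 10)) /
      (2 * Real.sqrt (Real.pi * 252)) := by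
    calc (0.0131 : ℝ) ≤ 2 / (3 * Real.pi * Real.sqrt 252) := by
          rw [le_div_iff₀ (by positivity)]; nlinarith
      _ = 4 / (3 * Real.sqrt Real.pi) / (2 * Real.sqrt (Real.pi * 252)) := by
          rw [Real.sqrt_mul hpi0.le]
          have : Real.sqrt Real.pi * Real.sqrt Real.pi = Real.pi := Real.mul_self_sqrt hpi0.le
          rw [div_div, div_eq_div_iff (by positivity) (by positivity)]
          linear_combination 12 * Real.sqrt 252 * this
      _ ≤ _ := by gcongr
  norm_num at hmain ⊢
  linarith

theorem mainTheorem5 :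
    ∃ ε : ℕ → ℕ → ℝ,
      -- `ε n s` is `o(1)` as `n → ∞`, uniformly in `s`
      (∀ η : ℝ, 0 < η → ∃ N : ℕ, ∀ n : ℕ, N ≤ n →
        ∀ s ∈ Finset.Icc 1 (n / 2 - 1), |ε n s| ≤ η) ∧
      -- for `n ≥ 6` it is the error in the entropy estimate of the partial binomial sums
      (∀ n : ℕ, 6 ≤ n → ∀ s ∈ Finset.Icc 1 (n / 2 - 1),
        (∑ k ∈ Finset.range (n / 2 - s + 1), (n.choose k : ℝ)) =
          (2 : ℝ) ^ ((n : ℝ) * (entropyTwo (alphaRatio n s) + ε n s))) ∧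
      ∀ n : ℕ, 5 ≤ n →
        (bisectionCount n : ℝ) / 2 ^ (n + 2) ≤
          erf (Real.pi * Real.sqrt ((2 * n).choose n : ℝ) / (2 * (n.choose (n / 2) : ℝ))) /
              (2 * Real.sqrt (Real.pi * ((2 * n).choose n : ℝ))) +
            ∑ s ∈ Finset.Icc 1 (n / 2 - 1),
              Real.exp
                  (-(Real.pi ^ 2 *
                        (2 : ℝ) ^ (2 * (n : ℝ) * (entropyTwo (alphaRatio n s) + ε n s)) /
                      (4 * (((n / 2 : ℕ) : ℝ) + 1) * (n.choose (n / 2 - s + 1) : ℝ) ^ 2))) *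
                ((s : ℝ) /
                  (((n / 2 - s + 1 : ℕ) : ℝ) * (n.choose (n / 2 - s + 1) : ℝ))) := by
  refine ⟨entropyError, exists_abs_entropyError_le,
    fun n hn s _ => sum_range_choose_eq_two_rpow n s hn, fun n hn => ?_⟩
  obtain rfl | h6 : n = 5 ∨ 6 ≤ n := by omega
  · have hε : entropyTwo (alphaRatio 5 1) + entropyError 5 1 = 0 := by simp [entropyError]
    have h5 : Nat.choose 5 2 = 10 := rfl
    have h10 : Nat.choose 10 5 = 252 := rfl
    refine le_trans (le_of_eq ?_) (bisectionCount_five_bound.trans (le_of_eq ?_))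
    · rw [bisectionCount_five]; norm_num
    · simp only [show 5 / 2 - 1 = 1 from rfl, Finset.Icc_self, Finset.sum_singleton, hε]
      norm_num [h5, h10]
  · have hlast : n / 2 - 1 ∈ Finset.Icc 1 (n / 2 - 1) := Finset.mem_Icc.2 ⟨by omega, le_rfl⟩
    have hidx : n / 2 - (n / 2 - 1) = 1 := by omega
    refine (bisectionCount_div_le n h6).trans ((le_exp_mul_last_term n h6).trans ?_)
    refine le_add_of_nonneg_of_le (div_nonneg (erf_nonneg (by positivity)) (by positivity))
      (le_trans (le_of_eq ?_) (Finset.single_le_sum (fun s _ => by positivity) hlast))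
    have hpow : (2 : ℝ) ^ (2 * (n : ℝ) * (entropyTwo (alphaRatio n (n / 2 - 1)) +
        entropyError n (n / 2 - 1))) = ((n : ℝ) + 1) ^ 2 := by
      rw [mul_assoc, mul_comm, Real.rpow_mul two_pos.le, ← sum_range_choose_eq_two_rpow n _ h6,
        hidx, Real.rpow_two]
      simp [Finset.sum_range_succ, add_comm]
    rw [hpow, hidx]
    norm_num
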